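/- Let $R$ be a local domain with field of fractions $K$, and let $R^{\mathrm h}$ be a henselisation of $R$: a henselian local ring together with a local morphism $R\to R^{\mathrm h}$ through which every local morphism from $R$ to a henselian local ring factors by a unique local morphism. A valuation $v$ of the field of fractions of a local domain $A$ is said to be centred in $A$ if $v(a)\ge 0$ for all $a\in A$ and the elements $a\in A$ with $v(a)>0$ are exactly those of the maximal ideal of $A$. Valuations are considered up to equivalence. Let $v$ be a valuation of $K$ centred in $R$. Then: (1) There is a unique prime ideal $H(v)$ of $R^{\mathrm h}$ lying over the zero ideal of $R$ such that $v$ extends, through the inclusion $R\subseteq R^{\mathrm h}/H(v)$, to a valuation $\tilde v$ of the field of fractions of $R^{\mathrm h}/H(v)$ which is centred in $R^{\mathrm h}/H(v)$. Moreover, $H(v)$ is a minimal prime ideal of $R^{\mathrm h}$, and the extension $\tilde v$ is unique (up to equivalence). (2) The valuations $v$ and $\tilde v$ have the same value group: the embedding of value groups induced by the inclusion of the fields of fractions is an isomorphism. -/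

import Mathlib

universe u u₁ u₂ u₃

/-- `Rh` is a henselisation of the local ring `R`: it is a henselian local ring with a local
morphism `R → Rh` through which every local morphism from `R` to a henselian local ring factors,
by a unique local morphism. -/
structure IsHenselisation (R Rh : Type u) [CommRing R] [CommRing Rh] [Algebra R Rh] : Prop where
  henselian : HenselianLocalRing Rh
  isLocalHom : IsLocalHom (algebraMap R Rh)
  existsUnique_lift : ∀ (S : Type u) [CommRing S] [HenselianLocalRing S] (φ : R →+* S),
    IsLocalHom φ → ∃! ψ : Rh →+* S, IsLocalHom ψ ∧ ψ.comp (algebraMap R Rh) = φ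

/-- The valuation `v` of the field of fractions of the local domain `A` is centred in `A`
(at its maximal ideal): it is nonnegative on `A` (at most `1` in multiplicative notation), and
the elements of `A` of positive valuation are those of the maximal ideal, i.e. the nonunits. -/
def IsCentredIn (A : Type*) [CommRing A] [IsDomain A] {Γ : Type*}
    [LinearOrderedCommGroupWithZero Γ] (v : Valuation (FractionRing A) Γ) : Prop :=
  (∀ a : A, v (algebraMap A (FractionRing A) a) ≤ 1) ∧
    ∀ a : A, v (algebraMap A (FractionRing A) a) < 1 ↔ a ∈ nonunits A

/-- If the prime `H` of the `R`-algebra `B` lies over the zero ideal of `R`, then `R → B ⧸ H` is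
injective. -/
theorem algebraMap_quotient_injective (R : Type*) {B : Type*} [CommRing R] [CommRing B]
    [Algebra R B] (H : Ideal B) [H.LiesOver (⊥ : Ideal R)] :
    Function.Injective (algebraMap R (B ⧸ H)) := by
  rw [injective_iff_map_eq_zero]
  intro a ha
  have h1 : algebraMap R B a ∈ H := by
    rw [← Ideal.Quotient.eq_zero_iff_mem]
    exact ha
  have h2 : a ∈ (⊥ : Ideal R) := (Ideal.mem_of_liesOver H ⊥ a).mpr h1
  simpa using h2

/-- The embedding of fields of fractions induced by the inclusion `R ⊆ B ⧸ H`, for a prime `H`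
of `B` lying over the zero ideal of the domain `R`. -/
noncomputable def fractionMap (R : Type*) {B : Type*} [CommRing R] [IsDomain R] [CommRing B]
    [Algebra R B] (H : Ideal B) [H.IsPrime] [H.LiesOver (⊥ : Ideal R)] :
    FractionRing R →+* FractionRing (B ⧸ H) :=
  IsFractionRing.map (algebraMap_quotient_injective R H)

/-!
The whole argument takes place in a separable closure `F` of the field of fractions `K` of `R`; no
description of the henselisation beyond its universal property is used.

Existence. Extend the valuation ring of `v` to a valuation ring `W` of `F`. Among the intermediate
fields on which `W` takes only the values it takes on `K`, choose a maximal one, `L`. Then the trace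
of `W` on `L` is henselian (`ValuationSubring.henselianLocalRing_comap`): a simple root `α` of a
polynomial modulo the maximal ideal generates an extension of `L` without new values. Indeed there
is some `β ∈ L(α)` which is a unit of `W` while its other conjugates over `L` are not.
Given `δ ∈ L(α)`, the element `β ^ k * δ` has, for a suitable `k`, a value shared by none of its
other conjugates, and the Newton polygon of its minimal polynomial shows that this value is attained
on `L`
(`ValuationSubring.exists_valuation_eq_of_mem_adjoin`). The universal property now gives a local
homomorphism from `Rh` to this trace. Its kernel is `H`, and the restriction of `W` is the
extension of `v`; it has no new values because `L` has none.

Uniqueness. Let `P` be a prime over zero, and let `U` be a valuation ring of the field of fractions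
of `Rh ⧸ P` which is centred in `Rh ⧸ P`. Extend `U` to an algebraic closure `Ω` of that field. The
trace of the extension on a copy of `F` in `Ω` is henselian, as every valuation ring of a separably
closed field is. So there is a lift of `R` to this trace, and by uniqueness of lifts to `Ω` it
coincides with the given map. Hence the field of fractions of `Rh ⧸ P` embeds in `F`, and `U` is
induced by a valuation ring of `F` (`IsHenselisation.exists_hom_separableClosure`). If `U` extends
`v`, then this valuation ring is conjugate to `W` (`ValuationSubring.exists_algEquiv_comap_eq`), so
after an automorphism it is `W`; uniqueness of lifts to `W` then gives `P = H` and identifies the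
two valuations.

Minimality. The same embedding, applied to any valuation ring centred in `Rh ⧸ P`, shows that
`Rh ⧸ P` is algebraic over `R` for every prime `P` over zero. So there are no inclusions between
distinct primes over zero.
-/

open Polynomial IsLocalRing IntermediateField

/-! ### Extension of valuation rings, and separably closed fields -/

namespace ValuationSubring

variable {K F : Type*} [Field K] [Field F]

theorem mem_nonunits_comap (W : ValuationSubring F) (f : K →+* F) (x : K) :
    x ∈ (W.comap f).nonunits ↔ f x ∈ W.nonunits := by
  rw [mem_nonunits_iff_or, mem_nonunits_iff_or, mem_comap, map_inv₀, map_eq_zero]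

theorem valuation_comap_le_iff (W : ValuationSubring F) (f : K →+* F) (x y : K) :
    (W.comap f).valuation x ≤ (W.comap f).valuation y ↔ W.valuation (f x) ≤ W.valuation (f y) := by
  have h : (W.comap f).valuation.IsEquiv (W.valuation.comap f) := by
    rw [Valuation.isEquiv_iff_val_le_one]
    intro x
    rw [valuation_le_one_iff, mem_comap, Valuation.comap_apply, valuation_le_one_iff]
  exact h x y

/-- The local inclusion of the restriction of a valuation ring to a subfield. -/
def comapHom (W : ValuationSubring F) (f : K →+* F) : W.comap f →+* W :=
  (f.comp (W.comap f).subtype).codRestrict W fun x => x.2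

theorem isLocalHom_comapHom (W : ValuationSubring F) (f : K →+* F) :
    IsLocalHom (W.comapHom f) where
  map_nonunit x hx := by
    by_contra hxu
    have h := (mem_nonunits_comap W f x).mp (coe_mem_nonunits_iff.mpr hxu)
    exact (coe_mem_nonunits_iff (a := W.comapHom f x)).mp h hx

/-- Every valuation ring of a field extends to any extension field. -/
theorem exists_comap_eq (V : ValuationSubring K) (f : K →+* F) :
    ∃ W : ValuationSubring F, W.comap f = V := by
  obtain ⟨W, h, hloc⟩ := IsLocalRing.exists_factor_valuationRing (f.comp V.subtype)
  refine ⟨W, ?_⟩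
  ext x
  rw [mem_comap]
  refine ⟨fun hx => ?_, fun hx => h ⟨x, hx⟩⟩
  by_contra hxV
  have hxinv : x⁻¹ ∈ V := (V.mem_or_inv_mem x).resolve_left hxV
  have hx0 : x ≠ 0 := fun e => hxV (e ▸ V.zero_mem)
  have hu : IsUnit (⟨x⁻¹, hxinv⟩ : V) := by
    refine hloc.map_nonunit _ (IsUnit.of_mul_eq_one ⟨f x, hx⟩ ?_)
    apply Subtype.ext
    change f x⁻¹ * f x = 1
    rw [← map_mul, inv_mul_cancel₀ hx0, map_one]
  obtain ⟨b, hb⟩ := hu.exists_right_inv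
  have hb' : x⁻¹ * (b : K) = 1 := congrArg Subtype.val hb
  exact hxV (by rw [inv_mul_eq_one₀ hx0] at hb'; exact hb' ▸ b.2)

theorem mem_of_isRoot (W : ValuationSubring F) {f : W[X]} (hf : f.Monic) {x : F}
    (hx : f.eval₂ W.subtype x = 0) : x ∈ W := by
  have : IsIntegral W x := ⟨f, hf, hx⟩
  obtain ⟨y, rfl⟩ := IsIntegrallyClosed.isIntegral_iff.mp this
  exact y.2

/-- In an algebraically closed field, a monic polynomial over a valuation ring splits over that
ring, so every approximate root is congruent to a root. -/
theorem exists_isRoot_of_isAlgClosed [IsAlgClosed F] (W : ValuationSubring F) {f : W[X]}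
    (hf : f.Monic) {a : W} (ha : f.eval a ∈ maximalIdeal W) :
    ∃ b : W, f.IsRoot b ∧ b - a ∈ maximalIdeal W := by
  have hs := IsAlgClosed.splits (f.map W.subtype)
  have hfm : (f.map W.subtype).Monic := hf.map _
  have hprod := hs.eval_eq_prod_roots_of_monic hfm (a : F)
  have hev : (f.map W.subtype).eval (a : F) = ((f.eval a : W) : F) := by
    rw [eval_map, ← W.subtype_apply, eval₂_at_apply, W.subtype_apply]
  by_contra! hcon
  have h1 : ∀ r ∈ (f.map W.subtype).roots, W.valuation ((a : F) - r) = 1 := by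
    intro r hr
    have hr0 : f.eval₂ W.subtype r = 0 := by
      rw [← eval_map]
      exact (mem_roots'.mp hr).2
    have hrW : r ∈ W := W.mem_of_isRoot hf hr0
    have := hcon ⟨r, hrW⟩ (by
      apply W.subtype_injective
      rw [← eval₂_at_apply, map_zero]
      exact hr0)
    rw [IsLocalRing.mem_maximalIdeal, _root_.mem_nonunits_iff, not_not, valuation_eq_one_iff] at this
    rw [Valuation.map_sub_swap]
    exact this
  have h2 : W.valuation ((f.map W.subtype).eval (a : F)) = 1 := by
    rw [hprod, map_multiset_prod, Multiset.map_map]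
    apply Multiset.prod_eq_one
    intro x hx
    obtain ⟨r, hr, rfl⟩ := Multiset.mem_map.mp hx
    exact h1 r hr
  rw [hev] at h2
  exact absurd h2 ((W.valuation_lt_one_iff _).mp ha).ne

/-- A valuation ring of a separably closed field is henselian: a root congruent to an
approximate simple root exists over an algebraic closure, and being simple it is separable. -/
theorem henselianLocalRing_of_isSepClosed [IsSepClosed F] (W : ValuationSubring F) :
    HenselianLocalRing W where
  is_henselian f hf a ha hfa := by
    let ι := algebraMap F (AlgebraicClosure F)
    obtain ⟨U, rfl⟩ := W.exists_comap_eq ι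
    let φ := U.comapHom ι
    have hφ : IsLocalHom φ := U.isLocalHom_comapHom ι
    obtain ⟨b, hb, hba⟩ := U.exists_isRoot_of_isAlgClosed (hf.map φ) (a := φ a) (by
      rw [eval_map, eval₂_at_apply]
      exact (map_mem_nonunits_iff φ _).mpr ha)
    -- the derivative at `b` is congruent to the derivative at `a`, hence nonzero
    have hder : (derivative (f.map φ)).eval b ≠ 0 := by
      intro h0
      have h1 : (derivative (f.map φ)).eval b - (derivative (f.map φ)).eval (φ a) ∈
          maximalIdeal U :=
        Ideal.mem_of_dvd _ (sub_dvd_eval_sub _ _ _) hba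
      rw [h0, zero_sub, neg_mem_iff, derivative_map, eval_map, eval₂_at_apply] at h1
      exact h1 (hfa.map φ)
    have hcomp : U.subtype.comp φ = ι.comp (U.comap ι).subtype := rfl
    let g : F[X] := f.map (U.comap ι).subtype
    have hgmap : g.map ι = (f.map φ).map U.subtype := by
      rw [Polynomial.map_map, Polynomial.map_map, hcomp]
    have hgb : aeval (b : AlgebraicClosure F) g = 0 := by
      rw [aeval_def, ← eval_map]
      change (g.map ι).eval _ = 0
      rw [hgmap, eval_map, ← U.subtype_apply, eval₂_at_apply, hb.eq_zero, map_zero]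
    have hgb' : aeval (b : AlgebraicClosure F) (derivative g) ≠ 0 := by
      rw [aeval_def, ← eval_map, ← derivative_map]
      change (derivative (g.map ι)).eval _ ≠ 0
      rw [hgmap, derivative_map, eval_map, ← U.subtype_apply, eval₂_at_apply]
      exact fun h => hder (U.subtype_injective (by rw [h, map_zero]))
    have hint : IsIntegral F (b : AlgebraicClosure F) := ⟨g, hf.map _, hgb⟩
    have hsep : (minpoly F (b : AlgebraicClosure F)).Separable := by
      rw [separable_iff_derivative_ne_zero (minpoly.irreducible hint)]
      intro h0
      obtain ⟨q, hq⟩ := minpoly.dvd F _ hgb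
      apply hgb'
      rw [hq, derivative_mul, h0, map_add, map_mul, map_mul, minpoly.aeval]
      simp
    obtain ⟨c, hc⟩ := minpoly.mem_range_of_degree_eq_one F _
      (IsSepClosed.degree_eq_one_of_irreducible F (minpoly.irreducible hint) hsep)
    have hcW : c ∈ U.comap ι := by
      rw [mem_comap]
      change algebraMap F (AlgebraicClosure F) c ∈ U
      rw [hc]
      exact b.2
    have hφc : φ ⟨c, hcW⟩ = b := Subtype.ext hc
    have hφinj : Function.Injective φ := fun x y hxy =>
      Subtype.ext (ι.injective (congrArg Subtype.val hxy))
    refine ⟨⟨c, hcW⟩, ?_, ?_⟩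
    · apply hφinj
      rw [← eval₂_at_apply, ← eval_map, hφc, map_zero]
      exact hb
    · rw [← hφc, ← map_sub] at hba
      exact fun h => hba (h.map φ)

end ValuationSubring

/-! ### Conjugacy of the extensions of a valuation ring -/

namespace ValuationSubring

variable {K F : Type*} [Field K] [Field F]

/-- An algebraic element is a root of a polynomial with coefficients in a given valuation ring
whose reduction is nonzero. -/
theorem exists_aeval_eq_zero_map_residue_ne_zero [Algebra K F] (V : ValuationSubring K) {x : F}
    (hx : IsAlgebraic K x) :
    ∃ p : V[X], p.eval₂ ((algebraMap K F).comp V.subtype) x = 0 ∧ p.map (residue V) ≠ 0 := by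
  obtain ⟨q, hq0, hq⟩ := hx
  obtain ⟨i, hi, hmax⟩ := q.support.exists_max_image (fun i => V.valuation (q.coeff i))
    (nonempty_support_iff.mpr hq0)
  have hc : q.coeff i ≠ 0 := mem_support_iff.mp hi
  have hle : ∀ n, V.valuation (q.coeff n) ≤ V.valuation (q.coeff i) := fun n => by
    by_cases hn : n ∈ q.support
    · exact hmax n hn
    · rw [notMem_support_iff.mp hn, map_zero]
      exact zero_le
  have hlift : C (q.coeff i)⁻¹ * q ∈ lifts V.subtype := by
    rw [lifts_iff_coeff_lifts]
    intro n
    rw [coeff_C_mul]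
    have : (q.coeff i)⁻¹ * q.coeff n ∈ V := by
      rw [← valuation_le_one_iff, map_mul, map_inv₀]
      exact inv_mul_le_one_of_le₀ (hle n) zero_le
    exact ⟨⟨_, this⟩, rfl⟩
  obtain ⟨p, hp⟩ := (mem_lifts _).mp hlift
  refine ⟨p, ?_, fun h0 => ?_⟩
  · rw [← eval₂_map, hp, eval₂_mul, ← aeval_def x q, hq, mul_zero]
  · have h1 : V.subtype (p.coeff i) = 1 := by
      rw [← coeff_map, hp, coeff_C_mul, inv_mul_cancel₀ hc]
    have h2 : p.coeff i = 1 := V.subtype_injective (by rw [h1, map_one])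
    have h3 := congrArg (fun r => r.coeff i) h0
    simp [h2] at h3

theorem valuation_eval₂_lt_one {V : ValuationSubring K} {U : ValuationSubring F} {f : K →+* F}
    (hU : U.comap f = V) {d : V[X]} (hd : d.map (residue V) = 0) {x : F} (hx : x ∈ U) :
    U.valuation (d.eval₂ (f.comp V.subtype) x) < 1 := by
  rw [eval₂_eq_sum, Polynomial.sum_def]
  refine Valuation.map_sum_lt _ one_ne_zero fun i _ => ?_
  have h1 : d.coeff i ∈ maximalIdeal V := by
    rw [← residue_eq_zero_iff, ← coeff_map, hd, coeff_zero]
  have h2 : U.valuation (f (d.coeff i)) < 1 := by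
    rw [← mem_nonunits_iff, ← mem_nonunits_comap, hU]
    exact coe_mem_nonunits_iff.mpr h1
  rw [map_mul, map_pow]
  exact mul_lt_one_of_lt_of_le h2 (pow_le_one₀ zero_le ((valuation_le_one_iff _ _).mpr hx))

/-- If `x` lies in `W₁` but not in `W₂`, two extensions of `V`, then some element `c` of all the
extensions of `V` is a unit in `W₁` but not in `W₂`. One may take `c = g(x)⁻¹`, where
`g = 1 + X q` and `q` is a monic polynomial whose reduction vanishes at the reduction of `x`
whenever the latter makes sense. -/
theorem exists_mem_nonunits_of_notMem [Algebra K F] (V : ValuationSubring K)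
    {W₁ W₂ : ValuationSubring F} (h₁ : W₁.comap (algebraMap K F) = V)
    (h₂ : W₂.comap (algebraMap K F) = V) {x : F} (hx : IsAlgebraic K x) (hx₁ : x ∈ W₁)
    (hx₂ : x ∉ W₂) :
    ∃ c : F, (∀ U : ValuationSubring F, U.comap (algebraMap K F) = V → c ∈ U) ∧
      c ∈ W₂.nonunits ∧ c ∉ W₁.nonunits := by
  obtain ⟨p, hp0, hp⟩ := V.exists_aeval_eq_zero_map_residue_ne_zero hx
  obtain ⟨u, hu⟩ := residue_surjective (p.map (residue V)).leadingCoeff⁻¹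
  have hmon : (C (residue V u) * p.map (residue V)).Monic := by
    rw [hu]
    exact monic_C_mul_of_mul_leadingCoeff_eq_one
      (inv_mul_cancel₀ (leadingCoeff_ne_zero.mpr hp))
  have hmap : C (residue V u) * p.map (residue V) = (C u * p).map (residue V) := by
    rw [Polynomial.map_mul, map_C]
  obtain ⟨q, hq, -, hqm⟩ := lifts_and_natDegree_eq_and_monic
    ((mem_lifts _).mpr ⟨C u * p, hmap.symm⟩) hmon
  have hg : (X * q + 1 : V[X]).Monic :=
    (monic_X.mul hqm).add_of_left (by
      rw [degree_one, degree_eq_natDegree (monic_X.mul hqm).ne_zero, natDegree_X_mul hqm.ne_zero]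
      exact_mod_cast Nat.succ_pos _)
  let φ := (algebraMap K F).comp V.subtype
  -- in a ring containing `x`, the value of `g` is congruent to `1`
  have hin : ∀ U : ValuationSubring F, U.comap (algebraMap K F) = V → x ∈ U →
      U.valuation ((X * q + 1 : V[X]).eval₂ φ x) = 1 := by
    intro U hU hxU
    have h0 : (q - C u * p).map (residue V) = 0 := by
      rw [Polynomial.map_sub, hq, hmap, sub_self]
    have h3 := valuation_eval₂_lt_one hU h0 hxU
    rw [eval₂_sub, eval₂_mul, hp0, mul_zero, sub_zero] at h3
    rw [eval₂_add, eval₂_mul, eval₂_X, eval₂_one]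
    rw [Valuation.map_add_eq_of_lt_right, map_one]
    rw [map_one, map_mul]
    exact (mul_le_of_le_one_left' ((valuation_le_one_iff _ _).mpr hxU)).trans_lt h3
  -- elsewhere the value of `g` is not integral, since `x` would be a root of a monic polynomial
  have hout : ∀ U : ValuationSubring F, U.comap (algebraMap K F) = V → x ∉ U →
      ((X * q + 1 : V[X]).eval₂ φ x)⁻¹ ∈ U.nonunits := by
    intro U hU hxU
    rw [mem_nonunits_iff_or, inv_inv]
    right
    intro hgx
    subst hU
    refine hxU (U.mem_of_isRoot
      (f := (X * q + 1 : (U.comap (algebraMap K F))[X]).map (U.comapHom _) - C ⟨_, hgx⟩)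
      ((hg.map _).sub_of_left ?_) ?_)
    · refine degree_C_le.trans_lt ?_
      rw [hg.degree_map, degree_eq_natDegree hg.ne_zero, natDegree_add_eq_left_of_natDegree_lt,
        natDegree_X_mul hqm.ne_zero]
      · exact_mod_cast Nat.succ_pos _
      · rw [natDegree_X_mul hqm.ne_zero, natDegree_one]
        exact Nat.succ_pos _
    · rw [eval₂_sub, eval₂_C, eval₂_map]
      exact sub_self _
  refine ⟨((X * q + 1 : V[X]).eval₂ φ x)⁻¹, fun U hU => ?_, hout W₂ h₂ hx₂, ?_⟩
  · by_cases hxU : x ∈ U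
    · rw [← valuation_le_one_iff, map_inv₀, hin U hU hxU, inv_one]
    · exact U.nonunits_le (hout U hU hxU)
  · rw [mem_nonunits_iff, map_inv₀, hin W₁ h₁ hx₁, inv_one]
    exact lt_irrefl _

section Conjugation

variable [Algebra K F]

/-- The intersection of all the extensions to `F` of a valuation ring `V` of `K`. -/
def iInfExtensions (F : Type*) [Field F] [Algebra K F] (V : ValuationSubring K) : Subring F :=
  ⨅ U : {U : ValuationSubring F // U.comap (algebraMap K F) = V}, U.1.toSubring

theorem mem_iInfExtensions {V : ValuationSubring K} {x : F} :
    x ∈ V.iInfExtensions F ↔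
      ∀ U : ValuationSubring F, U.comap (algebraMap K F) = V → x ∈ U := by
  simp [iInfExtensions, Subring.mem_iInf]

instance (V : ValuationSubring K) : IsInvariantSubring Gal(F/K) (V.iInfExtensions F) where
  smul_mem σ x hx := by
    rw [mem_iInfExtensions] at hx ⊢
    intro U hU
    refine hx (U.comap (σ : F →+* F)) ?_
    rw [comap_comap, ← hU]
    congr 1
    ext y
    exact σ.commutes y

instance (V : ValuationSubring K) : Algebra V (V.iInfExtensions F) :=
  (((algebraMap K F).comp V.subtype).codRestrict _ fun x => by
    rw [mem_iInfExtensions]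
    rintro U rfl
    exact x.2).toAlgebra

theorem coe_algebraMap_iInfExtensions (V : ValuationSubring K) (x : V) :
    (algebraMap V (V.iInfExtensions F) x : F) = algebraMap K F x :=
  rfl

/-- The valuation rings of a Galois extension of `K` that extend a given valuation ring of `K` are
conjugate. -/
theorem exists_algEquiv_comap_eq [IsGalois K F] (W₁ W₂ : ValuationSubring F)
    (h : W₁.comap (algebraMap K F) = W₂.comap (algebraMap K F)) :
    ∃ σ : Gal(F/K), W₂.comap (σ : F →+* F) = W₁ := by
  let V := W₁.comap (algebraMap K F)
  let B := V.iInfExtensions F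
  -- the traces of the maximal ideals on the intersection `B` of all extensions are primes over the
  -- same prime of `V`, and `V` consists of the invariants of the profinite Galois group in `B`
  let Q (W : ValuationSubring F) (hW : W.comap (algebraMap K F) = V) : Ideal B :=
    (maximalIdeal W).comap (Subring.inclusion
      (show B ≤ W.toSubring from fun x hx => mem_iInfExtensions.mp hx W hW))
  have hQmem : ∀ W hW (x : B), x ∈ Q W hW ↔ (x : F) ∈ W.nonunits := fun W hW x =>
    (coe_mem_nonunits_iff (A := W) (a := ⟨x, mem_iInfExtensions.mp x.2 W hW⟩)).symm
  have hQp : ∀ W hW, (Q W hW).IsPrime := fun W hW => Ideal.IsPrime.comap _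
  have hunder : ∀ W hW (x : V), x ∈ (Q W hW).under V ↔ (x : K) ∈ V.nonunits := fun W hW x => by
    rw [Ideal.mem_comap, hQmem W hW, coe_algebraMap_iInfExtensions, ← mem_nonunits_comap, hW]
  let _ : TopologicalSpace B := ⊥
  have _ : DiscreteTopology B := ⟨rfl⟩
  have _ : ContinuousSMul Gal(F/K) B := by
    rw [continuousSMul_iff_stabilizer_isOpen]
    intro x
    convert stabilizer_isOpen_of_isIntegral (K := K) (x : F) using 1
    ext σ
    exact Subtype.ext_iff
  have _ : SMulCommClass Gal(F/K) V B := ⟨fun σ a b => by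
    apply Subtype.ext
    rw [Algebra.smul_def, Algebra.smul_def]
    change σ (algebraMap K F a * b) = algebraMap K F a * σ b
    rw [map_mul, AlgEquiv.commutes]⟩
  have _ : Algebra.IsInvariant V B Gal(F/K) := ⟨fun b hb => by
    have hb' : (b : F) ∈ Set.range (algebraMap K F) := by
      rw [InfiniteGalois.mem_range_algebraMap_iff_fixed]
      exact fun σ => congrArg Subtype.val (hb σ)
    obtain ⟨a, ha⟩ := hb'
    have haV : a ∈ V := by
      rw [mem_comap, ha]
      exact mem_iInfExtensions.mp b.2 W₁ rfl
    exact ⟨⟨a, haV⟩, Subtype.ext ha⟩⟩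
  have := hQp W₁ rfl
  have := hQp W₂ h.symm
  obtain ⟨σ, hσ⟩ := Algebra.IsInvariant.exists_smul_of_under_eq_of_profinite (A := V)
    (G := Gal(F/K)) (Q W₁ rfl) (Q W₂ h.symm) (by
      ext x
      rw [hunder W₁ rfl, hunder W₂ h.symm])
  have hcomap : (W₂.comap (σ : F →+* F)).comap (algebraMap K F) = V := by
    rw [comap_comap, show V = _ from h]
    congr 1
    ext y
    exact σ.commutes y
  have hmem : ∀ x ∈ B, x ∈ (W₂.comap (σ : F →+* F)).nonunits ↔ x ∈ W₁.nonunits := by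
    intro x hx
    rw [mem_nonunits_comap]
    have h1 := hQmem W₂ h.symm (σ • ⟨x, hx⟩)
    rw [hσ, Ideal.smul_mem_pointwise_smul_iff, hQmem W₁ rfl] at h1
    exact h1.symm
  refine ⟨σ, ?_⟩
  ext x
  -- extensions of `V` whose maximal ideals have the same trace on `B` coincide
  have hx : IsAlgebraic K x := Algebra.IsAlgebraic.isAlgebraic x
  constructor <;> intro hx1 <;> by_contra hx2
  · obtain ⟨c, hc, hc1, hc2⟩ := V.exists_mem_nonunits_of_notMem hcomap rfl hx hx1 hx2
    exact hc2 ((hmem c (mem_iInfExtensions.mpr hc)).mpr hc1)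
  · obtain ⟨c, hc, hc1, hc2⟩ := V.exists_mem_nonunits_of_notMem rfl hcomap hx hx1 hx2
    exact hc2 ((hmem c (mem_iInfExtensions.mpr hc)).mp hc1)

end Conjugation

end ValuationSubring

/-! ### Henselian valuation rings without new values -/

namespace ValuationSubring

variable {K F : Type*} [Field K] [Field F]

/-- If no element of `s` has the value of `c`, then the reduction of the polynomial
`∏ r ∈ s, (c X - r)`, suitably scaled, is a power of `X`: a factor with `r` smaller than `c`
contributes `X`, and a factor with `r` larger than `c` contributes `1`. -/
theorem exists_prod_comp_eq_C_mul (W : ValuationSubring F) {c : F} (hc : c ≠ 0) (s : Finset F)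
    (hs : ∀ r ∈ s, W.valuation r ≠ W.valuation c) :
    ∃ (k : ℕ) (D : F) (p : W[X]), D ≠ 0 ∧
      (∏ r ∈ s, (X - C r)).comp (C c * X) = C D * p.map W.subtype ∧
      p.map (residue W) = X ^ k := by
  classical
  induction s using Finset.induction_on with
  | empty => exact ⟨0, 1, 1, one_ne_zero, by simp, by simp⟩
  | insert r s hr ih =>
    obtain ⟨k, D, p, hD, hp, hpk⟩ := ih fun r' hr' => hs r' (Finset.mem_insert_of_mem hr')
    have hvc : 0 < W.valuation c := zero_lt_iff.mpr ((Valuation.ne_zero_iff _).mpr hc)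
    rcases lt_or_gt_of_ne (hs r (Finset.mem_insert_self _ _)) with hlt | hlt
    · have hv : W.valuation (r / c) < 1 := by
        rw [map_div₀]
        exact (div_lt_one₀ hvc).mpr hlt
      let t : W := ⟨r / c, (valuation_le_one_iff _ _).mp hv.le⟩
      have ht : residue W t = 0 := (residue_eq_zero_iff _).mpr ((W.valuation_lt_one_iff t).mpr hv)
      refine ⟨k + 1, c * D, (X - C t) * p, mul_ne_zero hc hD, ?_, ?_⟩
      · rw [Finset.prod_insert hr, mul_comp, hp, Polynomial.map_mul, Polynomial.map_sub, map_X,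
          map_C, sub_comp, X_comp, C_comp, C_mul]
        have : (C r : F[X]) = C c * C (W.subtype t) := by
          rw [← C_mul]
          congr 1
          exact (mul_div_cancel₀ r hc).symm
        rw [this]
        ring
      · rw [Polynomial.map_mul, Polynomial.map_sub, map_X, map_C, ht, hpk, C_0, sub_zero, pow_succ']
    · have hr0 : r ≠ 0 := (Valuation.ne_zero_iff _).mp (hvc.trans hlt).ne'
      have hv : W.valuation (c / r) < 1 := by
        rw [map_div₀]
        exact (div_lt_one₀ (hvc.trans hlt)).mpr hlt
      let t : W := ⟨c / r, (valuation_le_one_iff _ _).mp hv.le⟩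
      have ht : residue W t = 0 := (residue_eq_zero_iff _).mpr ((W.valuation_lt_one_iff t).mpr hv)
      refine ⟨k, -r * D, (1 - C t * X) * p, mul_ne_zero (neg_ne_zero.mpr hr0) hD, ?_, ?_⟩
      · rw [Finset.prod_insert hr, mul_comp, hp, Polynomial.map_mul, Polynomial.map_sub,
          Polynomial.map_mul, map_X, map_C, Polynomial.map_one, sub_comp, X_comp, C_comp, C_mul,
          C_neg]
        have : (C c : F[X]) = C r * C (W.subtype t) := by
          rw [← C_mul]
          congr 1
          exact (mul_div_cancel₀ c hr0).symm
        rw [this]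
        ring
      · rw [Polynomial.map_mul, Polynomial.map_sub, Polynomial.map_mul, map_X, map_C, ht, hpk, C_0,
          zero_mul, sub_zero, Polynomial.map_one, one_mul]

/-- A segment of length one of a Newton polygon: if the root `c` of a polynomial is the only one
with its value, this value is the quotient of the values of two consecutive coefficients. -/
theorem exists_valuation_coeff_eq (W : ValuationSubring F) {c : F} (hc : c ≠ 0) (s : Finset F)
    (hs : ∀ r ∈ s, W.valuation r ≠ W.valuation c) :
    ∃ k : ℕ, W.valuation ((((X - C c) * ∏ r ∈ s, (X - C r)).coeff k) /
      (((X - C c) * ∏ r ∈ s, (X - C r)).coeff (k + 1))) = W.valuation c := by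
  obtain ⟨k, D, p, hD, hp, hpk⟩ := W.exists_prod_comp_eq_C_mul hc s hs
  have hcomp : ((X - C c) * ∏ r ∈ s, (X - C r)).comp (C c * X) =
      C (c * D) * ((X - 1) * p).map W.subtype := by
    rw [mul_comp, hp, sub_comp, X_comp, C_comp, Polynomial.map_mul, Polynomial.map_sub, map_X,
      Polynomial.map_one, C_mul]
    ring
  have hcoeff : ∀ n, ((X - C c) * ∏ r ∈ s, (X - C r)).coeff n * c ^ n =
      c * D * (((X - 1) * p).coeff n : W) := fun n => by
    rw [← comp_C_mul_X_coeff, hcomp, coeff_C_mul, coeff_map, W.subtype_apply]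
  have hres : ((X - 1) * p).map (residue W) = X ^ (k + 1) - X ^ k := by
    rw [Polynomial.map_mul, hpk, Polynomial.map_sub, map_X, Polynomial.map_one]
    ring
  have hval : ∀ n, (X ^ (k + 1) - X ^ k : (ResidueField W)[X]).coeff n ≠ 0 →
      W.valuation ((((X - 1) * p).coeff n : W) : F) = 1 := fun n hn => by
    rw [← hres, coeff_map, residue_ne_zero_iff_isUnit, valuation_eq_one_iff] at hn
    exact hn
  have h0 := congrArg W.valuation (hcoeff k)
  have h1 := congrArg W.valuation (hcoeff (k + 1))
  rw [map_mul, map_mul _ (c * D), hval _ (by simp [coeff_X_pow]), mul_one] at h0 h1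
  rw [← h1, pow_succ', map_mul W.valuation c, ← mul_assoc, map_pow] at h0
  have hck : W.valuation c ^ k ≠ 0 := pow_ne_zero _ ((Valuation.ne_zero_iff _).mpr hc)
  have h2 := mul_right_cancel₀ hck h0
  refine ⟨k, ?_⟩
  have hne : W.valuation (((X - C c) * ∏ r ∈ s, (X - C r)).coeff (k + 1)) ≠ 0 := by
    intro h
    rw [h, zero_mul] at h1
    exact (Valuation.ne_zero_iff _).mpr (mul_ne_zero hc hD) h1.symm
  rw [map_div₀, h2, mul_div_cancel_left₀ _ hne]

variable [Algebra K F] [IsGalois K F]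

/-- Suppose that some `β ∈ K(α)` is a unit of `W`, while the conjugates of `β` under the
automorphisms that move `α` are not. Then `K(α)` has the same values as `K`: after multiplication
by a power of `β`, an element of `K(α)` is the only one of its conjugates with its value, which can
be read off its minimal polynomial. -/
theorem exists_valuation_eq_of_mem_adjoin (W : ValuationSubring F) {α β δ : F} (hβ : β ∈ K⟮α⟯)
    (hβ1 : W.valuation β = 1)
    (hσ : ∀ σ : Gal(F/K), σ α ≠ α → W.valuation (σ β) < 1) (hδ : δ ∈ K⟮α⟯) :
    ∃ c : K, W.valuation (algebraMap K F c) = W.valuation δ := by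
  classical
  rcases eq_or_ne δ 0 with rfl | hδ0
  · exact ⟨0, by rw [map_zero]⟩
  have hβ0 : β ≠ 0 := by
    rintro rfl
    simp at hβ1
  have hvδ : W.valuation δ ≠ 0 := (Valuation.ne_zero_iff _).mpr hδ0
  -- each conjugate excludes at most one exponent, and there are finitely many conjugates
  have hfin : (⋃ bd ∈ (minpoly K β).rootSet F ×ˢ (minpoly K δ).rootSet F,
      {k : ℕ | bd.2 ≠ 0 ∧ W.valuation bd.1 < 1 ∧
        W.valuation (bd.1 ^ k * bd.2) = W.valuation δ}).Finite := by
    refine Set.Finite.biUnion ((rootSet_finite _ _).prod (rootSet_finite _ _)) fun bd _ => ?_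
    refine Set.Subsingleton.finite fun k hk l hl => ?_
    obtain ⟨hd, hb, hk⟩ := hk
    obtain ⟨-, -, hl⟩ := hl
    rw [← hl, map_mul, map_mul, map_pow, map_pow] at hk
    have hkl := mul_right_cancel₀ ((Valuation.ne_zero_iff _).mpr hd) hk
    rcases eq_or_ne bd.1 0 with hb0 | hb0
    · have hne : W.valuation (bd.1 ^ l * bd.2) ≠ 0 := by rw [hl]; exact hvδ
      have hne' : W.valuation bd.1 ^ k ≠ 0 := by
        rw [hkl, ← map_pow]
        exact fun h => hne (by rw [map_mul, h, zero_mul])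
      have hne'' : W.valuation bd.1 ^ l ≠ 0 := hkl ▸ hne'
      rw [hb0, map_zero, ne_eq, pow_eq_zero_iff', not_and_or, not_not] at hne' hne''
      simp only [not_true_eq_false, false_or] at hne' hne''
      rw [hne', hne'']
    · exact pow_right_injective₀ (zero_lt_iff.mpr ((Valuation.ne_zero_iff _).mpr hb0)) hb.ne hkl
  obtain ⟨k, hk⟩ := hfin.exists_notMem
  let θ := β ^ k * δ
  have hθ0 : θ ≠ 0 := mul_ne_zero (pow_ne_zero _ hβ0) hδ0
  have hvθ : W.valuation θ = W.valuation δ := by rw [map_mul, map_pow, hβ1, one_pow, one_mul]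
  have hθmem : θ ∈ K⟮α⟯ := MulMemClass.mul_mem (pow_mem hβ k) hδ
  have hroot : ∀ (σ : Gal(F/K)) (x : F), σ x ∈ (minpoly K x).rootSet F := fun σ x => by
    rw [mem_rootSet]
    refine ⟨minpoly.ne_zero (Algebra.IsIntegral.isIntegral x), ?_⟩
    rw [aeval_algHom_apply σ, minpoly.aeval, map_zero]
  have hconj : ∀ σ : Gal(F/K), σ θ ≠ θ → W.valuation (σ θ) ≠ W.valuation θ := by
    intro σ hne heq
    have hα : σ α ≠ α := fun h => hne <| by
      have hle : K⟮α⟯ ≤ fixedField (Subgroup.zpowers σ) := by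
        rw [adjoin_simple_le_iff]
        rintro ⟨τ, hτ⟩
        obtain ⟨n, rfl⟩ := Subgroup.mem_zpowers_iff.mp hτ
        have : σ ∈ MulAction.stabilizer Gal(F/K) α := h
        exact zpow_mem this n
      exact hle hθmem ⟨σ, Subgroup.mem_zpowers σ⟩
    apply hk
    simp only [Set.mem_iUnion]
    refine ⟨(σ β, σ δ), ⟨hroot σ β, hroot σ δ⟩, ?_, hσ σ hα, ?_⟩
    · exact (map_ne_zero σ).mpr hδ0
    · rw [← hvθ, ← heq, map_mul σ, map_pow σ]
  -- the minimal polynomial of `θ` has simple roots, and they are conjugates of `θ`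
  have hint : IsIntegral K θ := Algebra.IsIntegral.isIntegral θ
  have hsplit : ((minpoly K θ).map (algebraMap K F)).Splits := Normal.splits inferInstance θ
  have hnodup : ((minpoly K θ).map (algebraMap K F)).roots.Nodup :=
    nodup_roots (Separable.map (Algebra.IsSeparable.isSeparable K θ))
  let S : Finset F := ((minpoly K θ).map (algebraMap K F)).roots.toFinset
  have hprod : (minpoly K θ).map (algebraMap K F) = ∏ r ∈ S, (X - C r) := by
    have h := hsplit.eq_prod_roots_of_monic ((minpoly.monic hint).map _)
    rw [Finset.prod_multiset_map_count] at h
    rw [h]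
    refine Finset.prod_congr rfl fun r hr => ?_
    rw [Multiset.count_eq_one_of_mem hnodup (Multiset.mem_toFinset.mp hr), pow_one]
  have hS : ∀ r ∈ S, aeval r (minpoly K θ) = 0 := fun r hr => by
    have := (mem_roots'.mp (Multiset.mem_toFinset.mp hr)).2
    rwa [IsRoot, eval_map, ← aeval_def] at this
  have hθS : θ ∈ S := by
    rw [Multiset.mem_toFinset, mem_roots (map_ne_zero (minpoly.ne_zero hint)), IsRoot, eval_map,
      ← aeval_def, minpoly.aeval]
  obtain ⟨m, hm⟩ := W.exists_valuation_coeff_eq hθ0 (S.erase θ) fun r hr => by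
    obtain ⟨hrθ, hrS⟩ := Finset.mem_erase.mp hr
    obtain ⟨σ, rfl⟩ := minpoly.exists_algEquiv_of_root' hint.isAlgebraic (hS r hrS)
    exact hconj σ hrθ
  rw [Finset.mul_prod_erase S (fun r => X - C r) hθS, ← hprod, coeff_map, coeff_map, ← map_div₀,
    hvθ] at hm
  exact ⟨_, hm⟩

/-- Suppose that no `α ∉ K` generates an extension with the same values as `K`. Then the
restriction to `K` of a henselian valuation ring `W` is henselian: if `α ∈ W` is a root congruent
to the approximate simple root `a`, then the other roots are not congruent to `a`, and the element
`β = f(a) / (α - a)` shows that `K(α)` has the same values as `K`. -/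
theorem henselianLocalRing_comap (W : ValuationSubring F) [HenselianLocalRing W]
    (hmax : ∀ α : F, (∀ δ ∈ K⟮α⟯, ∃ c : K, W.valuation (algebraMap K F c) = W.valuation δ) →
      α ∈ Set.range (algebraMap K F)) :
    HenselianLocalRing (W.comap (algebraMap K F)) where
  is_henselian f hf a ha hfa := by
    let φ := W.comapHom (algebraMap K F)
    have hφ : IsLocalHom φ := W.isLocalHom_comapHom (algebraMap K F)
    have hφinj : Function.Injective φ := fun x y hxy =>
      Subtype.ext ((algebraMap K F).injective (congrArg Subtype.val hxy))
    have hφa : ∀ g : (W.comap (algebraMap K F))[X], (g.map φ).eval (φ a) = φ (g.eval a) :=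
      fun g => by rw [eval_map, eval₂_at_apply]
    obtain ⟨b, hb, hba⟩ := HenselianLocalRing.is_henselian (f.map φ) (hf.map φ) (φ a)
      (by rw [hφa]; exact (map_mem_nonunits_iff φ _).mpr ha)
      (by rw [derivative_map, hφa]; exact hfa.map φ)
    -- it suffices to show that the root `b` lies in `K`
    suffices hrange : (b : F) ∈ Set.range (algebraMap K F) by
      obtain ⟨c, hc⟩ := hrange
      have hcW : c ∈ W.comap (algebraMap K F) := by
        rw [mem_comap, hc]
        exact b.2
      have hφc : φ ⟨c, hcW⟩ = b := Subtype.ext hc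
      refine ⟨⟨c, hcW⟩, ?_, ?_⟩
      · apply hφinj
        rw [← eval₂_at_apply, ← eval_map, hφc, map_zero]
        exact hb
      · rw [← hφc, ← map_sub] at hba
        exact fun h => hba (h.map φ)
    obtain ⟨h, hh⟩ := dvd_iff_isRoot.mpr hb
    have hder : (derivative (f.map φ)).eval b = h.eval b := by
      rw [hh, derivative_mul]
      simp
    have hcongr : ∀ (g : W[X]) (x y : W), x - y ∈ maximalIdeal W →
        g.eval x - g.eval y ∈ maximalIdeal W := fun g x y hxy =>
      Ideal.mem_of_dvd _ (sub_dvd_eval_sub _ _ _) hxy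
    have hunit : ∀ x y : W, IsUnit y → x - y ∈ maximalIdeal W → IsUnit x := fun x y hy hxy => by
      by_contra hx
      exact (sub_sub_cancel x y ▸ sub_mem (show x ∈ maximalIdeal W from hx) hxy :
        y ∈ maximalIdeal W) hy
    have hhb : IsUnit (h.eval b) := by
      rw [← hder]
      refine hunit _ _ ?_ (hcongr _ b (φ a) hba)
      rw [derivative_map, hφa]
      exact hfa.map φ
    have hha : IsUnit (h.eval (φ a)) :=
      hunit _ _ hhb (hcongr _ _ _ (by rw [← neg_sub, neg_mem_iff]; exact hba))
    rcases eq_or_ne (b : F) (algebraMap K F a) with hab | hab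
    · exact ⟨a, hab.symm⟩
    have hab' : (b : F) - algebraMap K F a ≠ 0 := sub_ne_zero.mpr hab
    let e : K := (f.eval a : W.comap (algebraMap K F))
    have hfae : algebraMap K F e =
        -(((b : F) - algebraMap K F a) * (h.eval (φ a) : W)) := by
      have := congrArg Subtype.val (hφa f)
      rw [hh, eval_mul, eval_sub, eval_X, eval_C] at this
      refine Eq.trans this.symm ?_
      change (algebraMap K F a - b) * (h.eval (φ a) : W) = _
      ring
    have hve : W.valuation (algebraMap K F e) < 1 := by
      have := (map_mem_nonunits_iff φ _).mpr ha
      exact (W.valuation_lt_one_iff (φ (f.eval a))).mp this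
    have hvba : W.valuation ((b : F) - algebraMap K F a) < 1 := (W.valuation_lt_one_iff _).mp hba
    have haK : algebraMap K F a ∈ K⟮(b : F)⟯ := IntermediateField.algebraMap_mem _ _
    have heK : algebraMap K F e ∈ K⟮(b : F)⟯ := IntermediateField.algebraMap_mem _ _
    have hbK : (b : F) ∈ K⟮(b : F)⟯ := mem_adjoin_simple_self K (b : F)
    refine hmax b fun δ hδ => W.exists_valuation_eq_of_mem_adjoin
      (β := algebraMap K F e / ((b : F) - algebraMap K F a))
      (div_mem heK (sub_mem hbK haK)) ?_ ?_ hδ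
    · rw [hfae, neg_div, mul_div_cancel_left₀ _ hab', Valuation.map_neg]
      exact (W.valuation_eq_one_iff _).mp hha
    · intro σ hσ
      rw [map_div₀, map_sub, σ.commutes, σ.commutes, map_div₀]
      -- the conjugate of `b` is another root of `f`, so it is not congruent to `b`
      have hroot : (f.map φ).eval₂ W.subtype (σ b) = 0 := by
        have h1 : (f.map ((W.comap (algebraMap K F)).subtype)).aeval (b : F) = 0 := by
          have := hom_eval₂ f φ W.subtype b
          rw [← eval_map, hb.eq_zero, map_zero] at this
          rw [aeval_def, eval₂_map]
          exact this.symm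
        have h2 := aeval_algHom_apply σ (b : F) (f.map ((W.comap (algebraMap K F)).subtype))
        rw [h1, map_zero, aeval_def, eval₂_map] at h2
        rw [eval₂_map]
        exact h2
      let b' : W := ⟨σ b, W.mem_of_isRoot (hf.map φ) hroot⟩
      have hb' : (f.map φ).eval b' = 0 := by
        apply W.subtype_injective
        rw [← eval₂_at_apply, map_zero]
        exact hroot
      have hnot : IsUnit (b' - b) := by
        by_contra hcon
        have hh0 : h.eval b' = 0 := by
          rw [hh, eval_mul, eval_sub, eval_X, eval_C] at hb'
          refine (mul_eq_zero.mp hb').resolve_left fun h0 => hσ ?_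
          exact congrArg Subtype.val (sub_eq_zero.mp h0)
        have := hcongr h b' b hcon
        rw [hh0, zero_sub, neg_mem_iff] at this
        exact this hhb
      have hv : W.valuation (σ b - algebraMap K F a) = 1 := by
        have h1 : W.valuation (σ b - b) = 1 := (W.valuation_eq_one_iff _).mp hnot
        rw [← sub_add_sub_cancel (σ (b : F)) b, Valuation.map_add_eq_of_lt_left _ (by rwa [h1]), h1]
      rwa [hv, div_one]

/-- Every henselian valuation ring `W` of a Galois extension of `K` has a henselian trace on some
intermediate field `L` with the same values as `K`: take `L` maximal with these values. -/
theorem exists_intermediateField_henselianLocalRing_comap (W : ValuationSubring F)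
    [HenselianLocalRing W] :
    ∃ L : IntermediateField K F,
      (∀ x ∈ L, ∃ c : K, W.valuation (algebraMap K F c) = W.valuation x) ∧
      HenselianLocalRing (W.comap (algebraMap L F)) := by
  obtain ⟨L, -, hL, hmax⟩ := zorn_le_nonempty₀
    {L : IntermediateField K F |
      ∀ x ∈ L, ∃ c : K, W.valuation (algebraMap K F c) = W.valuation x}
    (fun c hc hchain M hM => by
      have : Nonempty c := ⟨⟨M, hM⟩⟩
      have hdir : Directed (· ≤ ·) (fun N : c => (N : IntermediateField K F)) :=
        hchain.directed
      refine ⟨⨆ N : c, (N : IntermediateField K F), fun x hx => ?_,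
        fun N hN => le_iSup (fun N : c => (N : IntermediateField K F)) ⟨N, hN⟩⟩
      rw [← SetLike.mem_coe, coe_iSup_of_directed hdir, Set.mem_iUnion] at hx
      obtain ⟨N, hN⟩ := hx
      exact hc N.2 x hN)
    ⊥ (fun x hx => by
      obtain ⟨c, rfl⟩ := mem_bot.mp hx
      exact ⟨c, rfl⟩)
  refine ⟨L, hL, W.henselianLocalRing_comap fun α hα => ?_⟩
  have hle : L ≤ (L⟮α⟯).restrictScalars K := fun x hx =>
    IntermediateField.algebraMap_mem L⟮α⟯ (⟨x, hx⟩ : L)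
  have hmem : α ∈ L := by
    refine hmax (y := (L⟮α⟯).restrictScalars K) (fun x hx => ?_) hle
      (mem_adjoin_simple_self L α)
    obtain ⟨c, hc⟩ := hα x hx
    obtain ⟨d, hd⟩ := hL c c.2
    exact ⟨d, hd.trans hc⟩
  exact ⟨⟨α, hmem⟩, rfl⟩

end ValuationSubring

/-! ### Local homomorphisms to valuation rings -/

/-- A ring homomorphism from `A` to a field is centred on the valuation ring `W` if it maps `A` to
`W`, and precisely the nonunits of `A` to nonunits of `W`. For a local ring `A` this says that it
induces a local homomorphism from `A` to `W`. -/
def IsCentredOn {A F : Type*} [CommRing A] [Field F] (φ : A →+* F) (W : ValuationSubring F) :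
    Prop :=
  ∀ a, φ a ∈ W ∧ (φ a ∈ W.nonunits ↔ a ∈ nonunits A)

theorem isCentredIn_iff_isCentredOn {A Γ : Type*} [CommRing A] [IsDomain A]
    [LinearOrderedCommGroupWithZero Γ] (v : Valuation (FractionRing A) Γ) :
    IsCentredIn A v ↔ IsCentredOn (algebraMap A (FractionRing A)) v.valuationSubring := by
  have h : ∀ x, x ∈ v.valuationSubring.nonunits ↔ v x < 1 := fun x => by
    rw [ValuationSubring.mem_nonunits_iff, ← v.isEquiv_valuation_valuationSubring.lt_one_iff_lt_one]
  simp only [IsCentredIn, IsCentredOn, h, Valuation.mem_valuationSubring_iff, forall_and]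

namespace IsCentredOn

variable {A B E F : Type*} [CommRing A] [CommRing B] [Field E] [Field F]

theorem comap_iff {φ : A →+* E} {j : E →+* F} {W : ValuationSubring F} :
    IsCentredOn φ (W.comap j) ↔ IsCentredOn (j.comp φ) W := by
  simp only [IsCentredOn, ValuationSubring.mem_comap, ValuationSubring.mem_nonunits_comap,
    RingHom.comp_apply]

theorem comp {φ : B →+* F} {W : ValuationSubring F} (hφ : IsCentredOn φ W) (f : A →+* B)
    [IsLocalHom f] : IsCentredOn (φ.comp f) W := fun a =>
  ⟨(hφ (f a)).1, (hφ (f a)).2.trans (map_mem_nonunits_iff f a)⟩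

theorem isLocalHom_codRestrict {φ : A →+* F} {W : ValuationSubring F} (hφ : IsCentredOn φ W) :
    IsLocalHom (φ.codRestrict W fun a => (hφ a).1) where
  map_nonunit a ha := by
    by_contra h
    exact (ValuationSubring.coe_mem_nonunits_iff (A := W)
      (a := φ.codRestrict W (fun a => (hφ a).1) a)).mp ((hφ a).2.mpr h) ha

theorem subtype_comp (W : ValuationSubring F) (f : A →+* W) [hf : IsLocalHom f] :
    IsCentredOn (W.subtype.comp f) W := fun a =>
  ⟨(f a).2, ValuationSubring.coe_mem_nonunits_iff.trans (map_mem_nonunits_iff f a)⟩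

end IsCentredOn

namespace IsHenselisation

variable {R Rh : Type u} [CommRing R] [CommRing Rh] [Algebra R Rh]
  {F : Type u} [Field F] (W : ValuationSubring F) [HenselianLocalRing W]

theorem exists_lift (hRh : IsHenselisation R Rh) {φ : R →+* F} (hφ : IsCentredOn φ W) :
    ∃ ψ : Rh →+* F, IsCentredOn ψ W ∧ ψ.comp (algebraMap R Rh) = φ := by
  obtain ⟨ψ, ⟨hψ, hψφ⟩, -⟩ := hRh.existsUnique_lift W _ hφ.isLocalHom_codRestrict
  exact ⟨W.subtype.comp ψ, IsCentredOn.subtype_comp W ψ, by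
    rw [RingHom.comp_assoc, hψφ]
    rfl⟩

theorem lift_unique (hRh : IsHenselisation R Rh) {ψ₁ ψ₂ : Rh →+* F} (h₁ : IsCentredOn ψ₁ W)
    (h₂ : IsCentredOn ψ₂ W) (h : ψ₁.comp (algebraMap R Rh) = ψ₂.comp (algebraMap R Rh)) :
    ψ₁ = ψ₂ := by
  have := hRh.isLocalHom
  obtain ⟨ψ, -, hψ⟩ := hRh.existsUnique_lift W _ (h₁.comp (algebraMap R Rh)).isLocalHom_codRestrict
  have e₁ := hψ _ ⟨h₁.isLocalHom_codRestrict, rfl⟩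
  have e₂ := hψ _ ⟨h₂.isLocalHom_codRestrict, by
    ext a
    exact (RingHom.congr_fun h a).symm⟩
  ext x
  exact congrArg Subtype.val (RingHom.congr_fun (e₁.trans e₂.symm) x)

end IsHenselisation

/-! ### Valuations centred in quotients of the henselisation -/

/-- The homomorphism from `B` to the field of fractions of its quotient by a prime. -/
noncomputable abbrev toFractionQuotient {B : Type*} [CommRing B] (P : Ideal B) [P.IsPrime] :
    B →+* FractionRing (B ⧸ P) :=
  (algebraMap (B ⧸ P) (FractionRing (B ⧸ P))).comp (Ideal.Quotient.mk P)

theorem fractionMap_comp_algebraMap {R B : Type*} [CommRing R] [IsDomain R] [CommRing B]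
    [Algebra R B] (P : Ideal B) [P.IsPrime] [P.LiesOver (⊥ : Ideal R)] :
    (fractionMap R P).comp (algebraMap R (FractionRing R)) =
      (toFractionQuotient P).comp (algebraMap R B) := by
  ext a
  exact IsLocalization.map_eq (M := nonZeroDivisors R) (T := nonZeroDivisors (B ⧸ P))
    (S := FractionRing R) (Q := FractionRing (B ⧸ P)) (g := algebraMap R (B ⧸ P))
    (nonZeroDivisors_le_comap_nonZeroDivisors_of_injective _ (algebraMap_quotient_injective R P)) a

theorem fractionRing_quotient_hom_ext {B E : Type*} [CommRing B] [Field E] (P : Ideal B)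
    [P.IsPrime] {j₁ j₂ : FractionRing (B ⧸ P) →+* E}
    (h : j₁.comp (toFractionQuotient P) = j₂.comp (toFractionQuotient P)) : j₁ = j₂ := by
  refine IsLocalization.ringHom_ext (nonZeroDivisors (B ⧸ P)) (Ideal.Quotient.ringHom_ext ?_)
  exact h

/-- A homomorphism from `B` to a field, with kernel `P`, factors through the field of fractions of
`B ⧸ P`. -/
theorem exists_comp_toFractionQuotient_eq {B E : Type*} [CommRing B] [Field E] (P : Ideal B)
    [P.IsPrime] (ψ : B →+* E) (h : RingHom.ker ψ = P) :
    ∃ j : FractionRing (B ⧸ P) →+* E, j.comp (toFractionQuotient P) = ψ := by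
  subst h
  refine ⟨IsFractionRing.lift (A := B ⧸ RingHom.ker ψ) (g := RingHom.kerLift ψ)
    (RingHom.kerLift_injective ψ), ?_⟩
  ext b
  rw [RingHom.comp_apply, RingHom.comp_apply, IsFractionRing.lift_algebraMap]
  rfl

theorem isCentredOn_toFractionQuotient {B : Type*} [CommRing B] [IsLocalRing B] {P : Ideal B}
    [P.IsPrime] {U : ValuationSubring (FractionRing (B ⧸ P))}
    (hU : IsCentredOn (algebraMap (B ⧸ P) (FractionRing (B ⧸ P))) U) :
    IsCentredOn (toFractionQuotient P) U :=
  have : IsLocalHom (Ideal.Quotient.mk P) :=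
    IsLocalHom.of_surjective _ Ideal.Quotient.mk_surjective
  hU.comp _

namespace IsHenselisation

variable {R Rh : Type u} [CommRing R] [IsDomain R] [CommRing Rh] [Algebra R Rh]

/-- Let `P` be a prime of the henselisation `Rh` of `R` lying over zero, and let `U` be a valuation
ring centred in `Rh ⧸ P`. Then the field of fractions of `Rh ⧸ P` embeds in the separable closure of
that of `R`, and `U` is the trace of a valuation ring of the latter. In fact `U` extends to an
algebraic closure `Ω` of the field of fractions of `Rh ⧸ P`, and its trace on the separable
closure of the field of fractions of `R` in `Ω` is henselian; by uniqueness of lifts, the image of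
`Rh` in `Ω` is contained in that separable closure. -/
theorem exists_hom_separableClosure (hRh : IsHenselisation R Rh) (P : Ideal Rh) [P.IsPrime]
    [P.LiesOver (⊥ : Ideal R)] {U : ValuationSubring (FractionRing (Rh ⧸ P))}
    (hU : IsCentredOn (algebraMap (Rh ⧸ P) (FractionRing (Rh ⧸ P))) U) :
    ∃ (j : FractionRing (Rh ⧸ P) →+* SeparableClosure (FractionRing R))
      (W : ValuationSubring (SeparableClosure (FractionRing R))),
      W.comap j = U ∧ j.comp (fractionMap R P) = algebraMap _ _ := by
  have := hRh.henselian
  have := hRh.isLocalHom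
  let K := FractionRing R
  let E := FractionRing (Rh ⧸ P)
  let Ω := AlgebraicClosure E
  let _ : Algebra K Ω := ((algebraMap E Ω).comp (fractionMap R P)).toAlgebra
  let k : SeparableClosure K →+* Ω := (IsSepClosed.lift : SeparableClosure K →ₐ[K] Ω)
  have hk : k.comp (algebraMap K (SeparableClosure K)) =
      (algebraMap E Ω).comp (fractionMap R P) :=
    AlgHom.comp_algebraMap (IsSepClosed.lift : SeparableClosure K →ₐ[K] Ω)
  obtain ⟨W', hW'⟩ := U.exists_comap_eq (algebraMap E Ω)
  have := W'.henselianLocalRing_of_isSepClosed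
  have := (W'.comap k).henselianLocalRing_of_isSepClosed
  let ψ₀ : Rh →+* Ω := (algebraMap E Ω).comp (toFractionQuotient P)
  have hψ₀ : IsCentredOn ψ₀ W' := by
    rw [← IsCentredOn.comap_iff, hW']
    exact isCentredOn_toFractionQuotient hU
  have hφ : k.comp ((algebraMap K (SeparableClosure K)).comp (algebraMap R K)) =
      ψ₀.comp (algebraMap R Rh) := by
    rw [← RingHom.comp_assoc, hk, RingHom.comp_assoc, fractionMap_comp_algebraMap]
    rfl
  obtain ⟨ψ, hψ, hψφ⟩ := hRh.exists_lift (W'.comap k)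
    (φ := (algebraMap K (SeparableClosure K)).comp (algebraMap R K)) (by
      rw [IsCentredOn.comap_iff, hφ]
      exact hψ₀.comp _)
  have hkψ : k.comp ψ = ψ₀ := by
    refine hRh.lift_unique W' (IsCentredOn.comap_iff.mp hψ) hψ₀ ?_
    rw [RingHom.comp_assoc, hψφ, hφ]
  have hker : RingHom.ker ψ = P := by
    rw [← RingHom.ker_comp_of_injective ψ k.injective, hkψ,
      RingHom.ker_comp_of_injective _ (algebraMap E Ω).injective,
      RingHom.ker_comp_of_injective _ (IsFractionRing.injective (Rh ⧸ P) E), Ideal.mk_ker]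
  obtain ⟨j, hj⟩ := exists_comp_toFractionQuotient_eq P ψ hker
  have hkj : k.comp j = algebraMap E Ω :=
    fractionRing_quotient_hom_ext P (by rw [RingHom.comp_assoc, hj, hkψ])
  refine ⟨j, W'.comap k, ?_, ?_⟩
  · rw [ValuationSubring.comap_comap, hkj, hW']
  · refine RingHom.ext fun x => k.injective ?_
    have h1 := RingHom.congr_fun hk x
    have h2 := RingHom.congr_fun hkj (fractionMap R P x)
    exact h2.trans h1.symm

/-- Fix a valuation ring `W` of the separable closure of the field of fractions `K` of `R`, and
a lift `ψ` of the inclusion of `R` that is centred on `W`. Every valuation ring `U` which is centred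
in a quotient of `Rh` and extends the trace of `W` on `K` is obtained by restricting `W` along an
embedding that extends `ψ`: by conjugacy `U` is the restriction of `W` along some embedding, and
lifts are unique. -/
theorem exists_hom_comap_eq (hRh : IsHenselisation R Rh)
    {W : ValuationSubring (SeparableClosure (FractionRing R))}
    {ψ : Rh →+* SeparableClosure (FractionRing R)} (hψ : IsCentredOn ψ W)
    (hψR : ψ.comp (algebraMap R Rh) = (algebraMap (FractionRing R) _).comp (algebraMap R _))
    (P : Ideal Rh) [P.IsPrime] [P.LiesOver (⊥ : Ideal R)]
    {U : ValuationSubring (FractionRing (Rh ⧸ P))}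
    (hU : IsCentredOn (algebraMap (Rh ⧸ P) (FractionRing (Rh ⧸ P))) U)
    (hUW : U.comap (fractionMap R P) = W.comap (algebraMap _ _)) :
    ∃ j : FractionRing (Rh ⧸ P) →+* SeparableClosure (FractionRing R),
      W.comap j = U ∧ j.comp (toFractionQuotient P) = ψ := by
  have := hRh.henselian
  obtain ⟨j₁, W₁, hj₁, hj₁R⟩ := hRh.exists_hom_separableClosure P hU
  obtain ⟨σ, hσ⟩ := W₁.exists_algEquiv_comap_eq W (by
    rw [← hUW, ← hj₁, ValuationSubring.comap_comap, hj₁R])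
  let j := (σ : SeparableClosure (FractionRing R) →+* SeparableClosure (FractionRing R)).comp j₁
  have hj : W.comap j = U := by rw [← ValuationSubring.comap_comap, hσ, hj₁]
  refine ⟨j, hj, ?_⟩
  have := W.henselianLocalRing_of_isSepClosed
  refine hRh.lift_unique W ?_ hψ ?_
  · rw [← IsCentredOn.comap_iff, hj]
    exact isCentredOn_toFractionQuotient hU
  · rw [hψR, RingHom.comp_assoc, ← fractionMap_comp_algebraMap, ← RingHom.comp_assoc,
      RingHom.comp_assoc _ j₁, hj₁R]
    exact RingHom.ext fun x => σ.commutes _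

/-- A prime of the henselisation lying over zero is minimal: for a prime `P ≤ H`, which also lies
over zero, the quotient `Rh ⧸ P` is algebraic over `R`, and a nonzero prime of a domain algebraic
over `R` does not lie over zero. -/
theorem mem_minimalPrimes [IsLocalRing R] (hRh : IsHenselisation R Rh) (H : Ideal Rh)
    [hH : H.IsPrime] [hHR : H.LiesOver (⊥ : Ideal R)] : H ∈ minimalPrimes Rh := by
  have := hRh.henselian
  refine ⟨⟨hH, bot_le⟩, fun P hP hPH => ?_⟩
  have hPp : P.IsPrime := hP.1
  have hPR : P.LiesOver (⊥ : Ideal R) := ⟨by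
    rw [eq_comm, eq_bot_iff, hHR.over]
    exact Ideal.comap_mono hPH⟩
  have : IsLocalRing (Rh ⧸ P) :=
    .of_surjective' (Ideal.Quotient.mk P) Ideal.Quotient.mk_surjective
  obtain ⟨U, hmem, hloc⟩ :=
    IsLocalRing.exists_factor_valuationRing (algebraMap (Rh ⧸ P) (FractionRing (Rh ⧸ P)))
  have hU : IsCentredOn (algebraMap (Rh ⧸ P) (FractionRing (Rh ⧸ P))) U :=
    IsCentredOn.subtype_comp U _ (hf := hloc)
  obtain ⟨j, W, -, hj⟩ := hRh.exists_hom_separableClosure P hU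
  let K := FractionRing R
  let ι : (Rh ⧸ P) →ₐ[R] SeparableClosure K :=
    { j.comp (algebraMap (Rh ⧸ P) (FractionRing (Rh ⧸ P))) with
      commutes' := fun r => by
        have h1 := RingHom.congr_fun (fractionMap_comp_algebraMap (R := R) P) r
        have h2 := RingHom.congr_fun hj (algebraMap R K r)
        rw [IsScalarTower.algebraMap_apply R K (SeparableClosure K), ← h2]
        exact congrArg j h1.symm }
  have hι : Function.Injective ι :=
    j.injective.comp (IsFractionRing.injective (Rh ⧸ P) (FractionRing (Rh ⧸ P)))
  intro a ha
  by_contra haP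
  have halg : IsAlgebraic R (Ideal.Quotient.mk P a) := by
    rw [← isAlgebraic_algHom_iff ι hι, IsFractionRing.isAlgebraic_iff R K]
    exact Algebra.IsAlgebraic.isAlgebraic _
  refine Ideal.comap_ne_bot_of_algebraic_mem (I := RingHom.ker (Ideal.Quotient.factor hPH))
    (fun h => haP (Ideal.Quotient.eq_zero_iff_mem.mp h))
    (show _ = _ from Ideal.Quotient.eq_zero_iff_mem.mpr ha) halg ?_
  rw [hHR.over]
  ext r
  exact Ideal.Quotient.eq_zero_iff_mem (I := H) (a := algebraMap R Rh r)

end IsHenselisation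

/-- A valuation ring `W` of `E` extending the valuation ring of a valuation `v` of `K`, and with the
same values, is the valuation ring of a valuation that extends `v` and has the same range. -/
theorem Valuation.exists_comap_eq_of_comap_valuationSubring_eq {K E Γ : Type*} [Field K] [Field E]
    [LinearOrderedCommGroupWithZero Γ] (v : Valuation K Γ) (W : ValuationSubring E) (i : K →+* E)
    (hW : W.comap i = v.valuationSubring)
    (h : ∀ x, ∃ c : K, W.valuation (i c) = W.valuation x) :
    ∃ w : Valuation E Γ, w.comap i = v ∧ w.valuationSubring = W ∧ Set.range w = Set.range v := by
  have hle : ∀ x y, v x ≤ v y ↔ W.valuation (i x) ≤ W.valuation (i y) := fun x y => by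
    rw [v.isEquiv_valuation_valuationSubring x y, ← hW, W.valuation_comap_le_iff]
  have heq : ∀ x y, W.valuation (i x) = W.valuation (i y) → v x = v y := fun x y hxy =>
    le_antisymm ((hle _ _).mpr hxy.le) ((hle _ _).mpr hxy.ge)
  choose f hf using h
  let w : Valuation E Γ :=
    { toFun := fun x => v (f x)
      map_zero' := by rw [heq (f 0) 0 (by rw [hf, map_zero i]), map_zero]
      map_one' := by rw [heq (f 1) 1 (by rw [hf, map_one i]), map_one]
      map_mul' := fun x y => by
        rw [heq (f (x * y)) (f x * f y) (by
          rw [hf, map_mul, map_mul, map_mul, hf, hf]), map_mul]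
      map_add_le_max' := fun x y => by
        rw [le_max_iff, hle, hle, hf, hf, hf, ← le_max_iff]
        exact W.valuation.map_add x y }
  have hw : ∀ c, w (i c) = v c := fun c => heq _ _ (hf (i c))
  refine ⟨w, Valuation.ext hw, ?_, ?_⟩
  · ext x
    rw [Valuation.mem_valuationSubring_iff, ← W.valuation_le_one_iff, ← hf x, ← map_one W.valuation,
      ← map_one i, ← hle, map_one v]
    rfl
  · ext g
    constructor
    · rintro ⟨x, rfl⟩
      exact ⟨f x, rfl⟩
    · rintro ⟨c, rfl⟩
      exact ⟨i c, hw c⟩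

theorem mainTheorem3 (R Rh : Type u₁) [CommRing R] [IsDomain R] [IsLocalRing R]
    [CommRing Rh] [Algebra R Rh] (hRh : IsHenselisation R Rh)
    (Γ : Type u₂) [LinearOrderedCommGroupWithZero Γ]
    (v : Valuation (FractionRing R) Γ) (hv : IsCentredIn R v) :
    ∃ (H : Ideal Rh) (_ : H.IsPrime) (_ : H.LiesOver (⊥ : Ideal R)),
      -- `v` extends to a valuation `w` centred in `Rh ⧸ H`, with the same value group
      (∃ w : Valuation (FractionRing (Rh ⧸ H)) Γ,
        w.comap (fractionMap R H) = v ∧ IsCentredIn (Rh ⧸ H) w ∧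
        MonoidWithZeroHom.valueGroup (.ofClass w) = MonoidWithZeroHom.valueGroup (.ofClass v) ∧
        -- every extension of `v` centred in `Rh ⧸ H` is equivalent to `w`
        ∀ (Γ' : Type u₃) [LinearOrderedCommGroupWithZero Γ']
          (w' : Valuation (FractionRing (Rh ⧸ H)) Γ'),
          (w'.comap (fractionMap R H)).IsEquiv v → IsCentredIn (Rh ⧸ H) w' → w'.IsEquiv w) ∧
      H ∈ minimalPrimes Rh ∧
      -- `H` is the only prime over zero such that `v` extends to a valuation centred in `Rh ⧸ H`
      ∀ (H' : Ideal Rh) [H'.IsPrime] [H'.LiesOver (⊥ : Ideal R)]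
        (Γ' : Type u₃) [LinearOrderedCommGroupWithZero Γ']
        (w' : Valuation (FractionRing (Rh ⧸ H')) Γ'),
        (w'.comap (fractionMap R H')).IsEquiv v → IsCentredIn (Rh ⧸ H') w' → H' = H := by
  have := hRh.henselian
  let K := FractionRing R
  let F := SeparableClosure K
  obtain ⟨W, hW⟩ := v.valuationSubring.exists_comap_eq (algebraMap K F)
  have := W.henselianLocalRing_of_isSepClosed
  obtain ⟨L, hL, hLh⟩ := W.exists_intermediateField_henselianLocalRing_comap (K := K)
  have hcent : IsCentredOn ((algebraMap K L).comp (algebraMap R K)) (W.comap (algebraMap L F)) := by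
    rw [← IsCentredOn.comap_iff, ValuationSubring.comap_comap]
    change IsCentredOn (algebraMap R K) (W.comap (algebraMap K F))
    rw [hW]
    exact (isCentredIn_iff_isCentredOn v).mp hv
  obtain ⟨χ, hχ, hχR⟩ := hRh.exists_lift (W.comap (algebraMap L F)) hcent
  let ψ : Rh →+* F := (algebraMap L F).comp χ
  have hψ : IsCentredOn ψ W := IsCentredOn.comap_iff.mp hχ
  have hψR : ψ.comp (algebraMap R Rh) = (algebraMap K F).comp (algebraMap R K) := by
    rw [RingHom.comp_assoc, hχR]
    rfl
  let H : Ideal Rh := RingHom.ker χ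
  have hHψ : RingHom.ker ψ = H := RingHom.ker_comp_of_injective χ (algebraMap L F).injective
  have hHp : H.IsPrime := RingHom.ker_isPrime χ
  have hHR : H.LiesOver (⊥ : Ideal R) := ⟨by
    rw [Ideal.under_def, RingHom.comap_ker, hχR, eq_comm, ← RingHom.injective_iff_ker_eq_bot]
    exact (algebraMap K L).injective.comp (IsFractionRing.injective R K)⟩
  obtain ⟨l, hl⟩ := exists_comp_toFractionQuotient_eq H χ rfl
  let j : FractionRing (Rh ⧸ H) →+* F := (algebraMap L F).comp l
  have hj : j.comp (toFractionQuotient H) = ψ := by rw [RingHom.comp_assoc, hl]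
  have hjK : j.comp (fractionMap R H) = algebraMap K F := by
    refine IsLocalization.ringHom_ext (nonZeroDivisors R) ?_
    rw [RingHom.comp_assoc, fractionMap_comp_algebraMap, ← RingHom.comp_assoc, hj, hψR]
  obtain ⟨w, hwv, hwW, hwrange⟩ := v.exists_comap_eq_of_comap_valuationSubring_eq (W.comap j)
    (fractionMap R H) (by rw [ValuationSubring.comap_comap, hjK, hW]) fun x => by
      obtain ⟨c, hc⟩ := hL (j x) (l x).2
      refine ⟨c, le_antisymm ?_ ?_⟩ <;> rw [W.valuation_comap_le_iff]
      · exact (congrArg W.valuation (RingHom.congr_fun hjK c)).trans hc |>.le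
      · exact (congrArg W.valuation (RingHom.congr_fun hjK c)).trans hc |>.ge
  -- any extension of `v` centred in a quotient of `Rh` is the restriction of `W` along `ψ`
  have key : ∀ (P : Ideal Rh) [P.IsPrime] [P.LiesOver (⊥ : Ideal R)] (Γ' : Type u₃)
      [LinearOrderedCommGroupWithZero Γ'] (w' : Valuation (FractionRing (Rh ⧸ P)) Γ'),
      (w'.comap (fractionMap R P)).IsEquiv v → IsCentredIn (Rh ⧸ P) w' →
      ∃ j' : FractionRing (Rh ⧸ P) →+* F,
        W.comap j' = w'.valuationSubring ∧ j'.comp (toFractionQuotient P) = ψ := by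
    intro P _ _ Γ' _ w' hw'v hw'
    refine hRh.exists_hom_comap_eq hψ hψR P ((isCentredIn_iff_isCentredOn w').mp hw') ?_
    rw [hW]
    exact ((w'.comap (fractionMap R P)).isEquiv_iff_valuationSubring v).mp hw'v
  refine ⟨H, hHp, hHR, ⟨w, hwv, ?_, ?_, ?_⟩, hRh.mem_minimalPrimes H, ?_⟩
  · rw [isCentredIn_iff_isCentredOn, hwW]
    have hloc : IsLocalHom (Ideal.Quotient.mk H) :=
      IsLocalHom.of_surjective _ Ideal.Quotient.mk_surjective
    intro a
    obtain ⟨b, rfl⟩ := Ideal.Quotient.mk_surjective a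
    have hb := hψ b
    rw [← hj] at hb
    exact ⟨hb.1, (W.mem_nonunits_comap j _).trans
      (hb.2.trans (map_mem_nonunits_iff (Ideal.Quotient.mk H) b).symm)⟩
  · rw [MonoidWithZeroHom.valueGroup_def, MonoidWithZeroHom.valueGroup_def]
    congr 1
    ext g
    change (g : Γ) ∈ Set.range w ↔ (g : Γ) ∈ Set.range v
    rw [hwrange]
  · intro Γ' _ w' hw'v hw'
    obtain ⟨j', hj'W, hj'⟩ := key H Γ' w' hw'v hw'
    have hjj' : j' = j := fractionRing_quotient_hom_ext H (hj'.trans hj.symm)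
    rw [Valuation.isEquiv_iff_valuationSubring, hwW, ← hj'W, hjj']
  · intro P _ _ Γ' _ w' hw'v hw'
    obtain ⟨j', -, hj'⟩ := key P Γ' w' hw'v hw'
    rw [← hHψ, ← hj', RingHom.ker_comp_of_injective _ j'.injective,
      RingHom.ker_comp_of_injective _ (IsFractionRing.injective (Rh ⧸ P) _), Ideal.mk_ker]
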